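/- Let $\Gamma$ be a discrete group (possibly uncountable) and let $\alpha$ be a continuous action of $\Gamma$ on a compact Hausdorff space $X$ (possibly non-metrizable). Assume that $\alpha$ is minimal (every orbit is dense) and essentially free (for every $g\in\Gamma\setminus\{e\}$ the set $\{x\in X : gx=x\}$ has empty interior), and that the reduced crossed product $C(X)\rtimes_{\mathrm r}\Gamma$ is purely infinite. Let $\beta$ be any minimal extension of $\alpha$, that is, a minimal continuous action of $\Gamma$ on a compact Hausdorff space $Y$ for which there is a $\Gamma$-equivariant quotient map $Y\to X$. Then the reduced crossed product $C(Y)\rtimes_{\mathrm r}\Gamma$ is purely infinite. Here a unital C$^\ast$-algebra $A$ is called purely infinite if it is simple and for every nonzero positive element $a\in A$ there is $x\in A$ with $xax^\ast=1$. The reduced crossed product $C(X)\rtimes_{\mathrm r}\Gamma$ is the C$^\ast$-algebra of bounded operators on $\ell^2(\Gamma\times X)$ generated by the operators $(f\xi)(g,x)=f(gx)\,\xi(g,x)$, $f\in C(X)$, and $(\lambda_s\xi)(g,x)=\xi(s^{-1}g,x)$, $s\in\Gamma$. -/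

import Mathlib

noncomputable section

namespace CrossedProduct

universe u v w

/-- The Hilbert space `ℓ²(ι)` of square-summable complex families. -/
abbrev EllTwo (ι : Type u) : Type u := lp (fun _ : ι => ℂ) 2

/-- The bounded operator `ξ ↦ m · (ξ ∘ σ)` on `ℓ²(ι)`, where `m` is a bounded function and `σ` is
a permutation of `ι`. -/
def weightedShift {ι : Type u} (m : ι → ℂ) (C : ℝ) (hC : 0 ≤ C) (hm : ∀ i, ‖m i‖ ≤ C)
    (σ : Equiv.Perm ι) : EllTwo ι →L[ℂ] EllTwo ι :=
  have hsum : ∀ ξ : EllTwo ι, HasSum (fun i => ‖ξ (σ i)‖ ^ (2 : ℝ)) (‖ξ‖ ^ (2 : ℝ)) := fun ξ => by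
    have h := lp.hasSum_norm (p := 2) (by norm_num) ξ
    simp only [ENNReal.toReal_ofNat] at h
    exact (Equiv.hasSum_iff σ).2 h
  have hle : ∀ (ξ : EllTwo ι) (i : ι),
      ‖m i * ξ (σ i)‖ ^ (2 : ℝ) ≤ C ^ (2 : ℝ) * ‖ξ (σ i)‖ ^ (2 : ℝ) := fun ξ i => by
    rw [norm_mul, Real.mul_rpow (norm_nonneg _) (norm_nonneg _)]
    gcongr
    exact hm i
  have hmem : ∀ ξ : EllTwo ι, Memℓp (fun i => m i * ξ (σ i)) 2 := fun ξ => by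
    refine memℓp_gen ?_
    simp only [ENNReal.toReal_ofNat]
    exact Summable.of_nonneg_of_le (fun i => by positivity) (hle ξ) ((hsum ξ).summable.mul_left _)
  LinearMap.mkContinuous
    { toFun := fun ξ => ⟨fun i => m i * ξ (σ i), hmem ξ⟩
      map_add' := fun ξ η => by ext i; exact mul_add _ _ _
      map_smul' := fun c ξ => by ext i; simp [mul_left_comm] }
    C (fun ξ => by
      refine lp.norm_le_of_tsum_le (by norm_num) (by positivity) ?_
      simp only [ENNReal.toReal_ofNat]
      rw [Real.mul_rpow hC (norm_nonneg _), ← (hsum ξ).tsum_eq, ← tsum_mul_left]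
      refine Summable.tsum_le_tsum (hle ξ) ?_ ((hsum ξ).summable.mul_left _)
      exact Summable.of_nonneg_of_le (fun i => by positivity) (hle ξ)
        ((hsum ξ).summable.mul_left _))

section RegularRepresentation

variable (Γ : Type u) (X : Type v) [Group Γ] [TopologicalSpace X] [CompactSpace X]
  [MulAction Γ X]

/-- The function `f ∈ C(X)` acts on `ℓ²(Γ × X)` by `(f ξ)(g, x) = f(g x) ξ(g, x)`. This is the
representation `⨁_g (f ∘ g)` of `C(X)` on `ℓ²(Γ) ⊗ ℓ²(X)` induced from the faithful
representation of `C(X)` on `ℓ²(X)` by multiplication. -/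
def coeffRep (f : C(X, ℂ)) : EllTwo (Γ × X) →L[ℂ] EllTwo (Γ × X) :=
  weightedShift (fun p => f (p.1 • p.2)) ‖f‖ (norm_nonneg f) (fun _ => f.norm_coe_le_norm _) 1

/-- The group element `s` acts on `ℓ²(Γ × X)` by `(λ_s ξ)(g, x) = ξ(s⁻¹ g, x)`. -/
def groupRep (s : Γ) : EllTwo (Γ × X) →L[ℂ] EllTwo (Γ × X) :=
  weightedShift (fun _ => 1) 1 zero_le_one (fun _ => by simp)
    ((Equiv.mulLeft s⁻¹).prodCongr (Equiv.refl X))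

/-- The reduced crossed product `C(X) ⋊_r Γ` inside the bounded operators on `ℓ²(Γ × X)`: the
norm-closed unital `*`-subalgebra generated by `C(X)` and `Γ` in the regular representation. -/
def reducedSubalgebra : StarSubalgebra ℂ (EllTwo (Γ × X) →L[ℂ] EllTwo (Γ × X)) :=
  (StarAlgebra.adjoin ℂ
    (Set.range (coeffRep Γ X) ∪ Set.range (groupRep Γ X))).topologicalClosure

/-- The reduced crossed product `C(X) ⋊_r Γ`. -/
def ReducedCrossedProduct : Type (max u v) := reducedSubalgebra Γ X

instance reducedSubalgebra_isClosed :
    IsClosed (reducedSubalgebra Γ X : Set (EllTwo (Γ × X) →L[ℂ] EllTwo (Γ × X))) :=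
  StarSubalgebra.isClosed_topologicalClosure _

instance : CStarAlgebra (ReducedCrossedProduct Γ X) :=
  inferInstanceAs (CStarAlgebra (reducedSubalgebra Γ X))

instance : PartialOrder (ReducedCrossedProduct Γ X) :=
  CStarAlgebra.spectralOrder _

instance : StarOrderedRing (ReducedCrossedProduct Γ X) :=
  CStarAlgebra.spectralOrderedRing _

end RegularRepresentation

/-- A unital C*-algebra is (simple and) purely infinite if it is simple and for every nonzero
positive element `a` there is `x` with `x a x* = 1`. -/
def IsPurelyInfinite (A : Type u) [CStarAlgebra A] [PartialOrder A] [StarOrderedRing A] : Prop :=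
  IsSimpleRing A ∧ ∀ a : A, 0 ≤ a → a ≠ 0 → ∃ x : A, x * a * star x = 1

/-- An action of a discrete group `Γ` on `X` is essentially free if the set of all
`(g, x) ∈ Γ × X` with `g ≠ 1` and `g x = x` has empty interior. As `Γ` is discrete, this says that
the fixed point set of each `g ≠ 1` has empty interior. -/
def EssentiallyFree (Γ : Type u) (X : Type v) [Group Γ] [TopologicalSpace X] [MulAction Γ X] :
    Prop :=
  ∀ g : Γ, g ≠ 1 → interior (MulAction.fixedBy X g) = ∅

/-- The action of `Γ` on `Y` is an extension of the action on `X` if there is a `Γ`-equivariant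
quotient map from `Y` to `X`. -/
def IsExtension (Γ : Type u) (Y : Type v) (X : Type w) [Group Γ] [TopologicalSpace Y]
    [TopologicalSpace X] [MulAction Γ Y] [MulAction Γ X] : Prop :=
  ∃ π : Y → X, Topology.IsQuotientMap π ∧ ∀ (g : Γ) (y : Y), π (g • y) = g • π y

end CrossedProduct

end

/-! Let `a` be positive and nonzero in the crossed product of `Y`. Some diagonal matrix coefficient
of `a` is a number `r > 0`. Approximate `a` by a finite sum and compress it with a bump function `f`
that is orthogonal to its translates by the group elements involved: only the coefficient at `1`
survives, and it is close to `r` on the support of `f`. If `f²` can be conjugated to `1`, then `a`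
can be conjugated close to `r`, hence to `1` (`exists_conj_eq_one_of_coeff`). Essential freeness of
`Y`, which provides `f`, is inherited from `X`.

To conjugate `f²` to `1` (`exists_conj_coeff_eq_one`), minimality of `Y` gives finitely many
translates of `f²` with strictly positive sum. A conjugation by `∑ λ_t` produces this sum plus cross
terms, and a bump function `h` on `X`, pulled back to `Y`, kills the cross terms. What remains,
after normalisation, is the pullback of `h²`, and pure infiniteness over `X` applies to `h²`. The
conjugating element passes to `Y` through finite sums, with norms compared orbit by orbit; no
homomorphism between the crossed products is needed. -/

noncomputable section

namespace CrossedProduct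

universe u v w

set_option linter.unusedSectionVars false

/-! ### Conjugation to the unit in C*-algebras. -/

section CStar

variable {A : Type u} [CStarAlgebra A] [PartialOrder A] [StarOrderedRing A]

/-- If a conjugate `k a k*` of a positive element is close enough to a positive scalar, then some
conjugate of `a` is equal to `1`. -/
lemma exists_conj_eq_one_of_norm_sub_lt {a k : A} (ha : 0 ≤ a) {r : ℝ}
    (h : ‖k * a * star k - (r : ℂ) • (1 : A)‖ < r) : ∃ x : A, x * a * star x = 1 := by
  have hr : 0 < r := (norm_nonneg _).trans_lt h
  have hrC : (r : ℂ) ≠ 0 := by exact_mod_cast hr.ne'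
  set z : A := k * a * star k with hz
  have hz0 : 0 ≤ z := star_right_conjugate_nonneg ha k
  have hunit : IsUnit z := by
    have h1 : ‖(r : ℂ)⁻¹ • ((r : ℂ) • (1 : A) - z)‖ < 1 := by
      rw [norm_smul, norm_inv, Complex.norm_real, Real.norm_of_nonneg hr.le, norm_sub_rev,
        inv_mul_lt_one₀ hr]
      exact h
    have h2 := isUnit_one_sub_of_norm_lt_one h1
    have h3 : (1 : A) - (r : ℂ)⁻¹ • ((r : ℂ) • (1 : A) - z) = (r : ℂ)⁻¹ • z := by
      rw [smul_sub, smul_smul, inv_mul_cancel₀ hrC, one_smul, sub_sub_cancel]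
    rw [h3] at h2
    have h4 := h2.smul (Units.mk0 (r : ℂ) hrC)
    rwa [Units.smul_mk0, smul_smul, mul_inv_cancel₀ hrC, one_smul] at h4
  have hs : CFC.sqrt z * CFC.sqrt z = z := CFC.sqrt_mul_sqrt_self z hz0
  have hsu : IsUnit (CFC.sqrt z) := by rw [← hs] at hunit; exact isUnit_mul_self_iff.1 hunit
  have hsa : star (CFC.sqrt z) = CFC.sqrt z := (CFC.sqrt_nonneg z).isSelfAdjoint
  obtain ⟨t, ht⟩ := hsu
  have hst : star (↑t⁻¹ : A) = ↑t⁻¹ := by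
    have : star t = t := Units.ext (by rw [Units.coe_star, ht, hsa])
    rw [← Units.coe_star, star_inv, this]
  -- Here `t` is the square root of the invertible positive element `z`, so `k` is corrected by
  -- `z^(-1/2)`.
  refine ⟨↑t⁻¹ * k, ?_⟩
  calc ↑t⁻¹ * k * a * star (↑t⁻¹ * k) = ↑t⁻¹ * z * ↑t⁻¹ := by
        rw [star_mul, hst, hz]; simp only [mul_assoc]
    _ = 1 := by rw [← hs, ← ht, ← mul_assoc, Units.inv_mul, one_mul, Units.mul_inv]

/-- The condition on positive elements in the definition of pure infiniteness implies
simplicity. -/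
lemma isPurelyInfinite_of_exists_conj_eq_one [Nontrivial A]
    (h : ∀ a : A, 0 ≤ a → a ≠ 0 → ∃ x : A, x * a * star x = 1) : IsPurelyInfinite A := by
  refine ⟨⟨⟨fun I => ?_⟩⟩, h⟩
  rw [or_iff_not_imp_left]
  intro hI
  obtain ⟨a, haI, ha⟩ : ∃ a ∈ I, a ≠ 0 := by
    by_contra! hcon
    exact hI (eq_bot_iff.2 fun a ha => by
      rw [hcon a ha]; exact zero_mem _)
  obtain ⟨x, hx⟩ := h (star a * a) (star_mul_self_nonneg a)
    (CStarRing.star_mul_self_ne_zero_iff a |>.2 ha)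
  rw [← I.one_mem_iff, ← hx]
  exact I.mul_mem_right _ _ (I.mul_mem_left _ _ (I.mul_mem_left _ _ haI))

end CStar

/-! ### Generators, finite sums and diagonal matrix coefficients. -/

section Generators

variable (Γ : Type u) (X : Type v) [Group Γ] [TopologicalSpace X] [CompactSpace X]
  [MulAction Γ X]

lemma coeffRep_apply (f : C(X, ℂ)) (ξ : EllTwo (Γ × X)) (p : Γ × X) :
    coeffRep Γ X f ξ p = f (p.1 • p.2) * ξ p := rfl

lemma groupRep_apply (s : Γ) (ξ : EllTwo (Γ × X)) (p : Γ × X) :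
    groupRep Γ X s ξ p = ξ (s⁻¹ * p.1, p.2) := one_mul _

lemma star_coeffRep (f : C(X, ℂ)) : star (coeffRep Γ X f) = coeffRep Γ X (star f) := by
  symm
  rw [ContinuousLinearMap.star_eq_adjoint, ContinuousLinearMap.eq_adjoint_iff]
  intro ξ η
  rw [lp.inner_eq_tsum, lp.inner_eq_tsum]
  refine tsum_congr fun p => ?_
  simp only [coeffRep_apply, RCLike.inner_apply, map_mul, ContinuousMap.star_apply,
    RCLike.star_def, RCLike.conj_conj]
  ring

lemma star_groupRep (s : Γ) : star (groupRep Γ X s) = groupRep Γ X s⁻¹ := by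
  symm
  rw [ContinuousLinearMap.star_eq_adjoint, ContinuousLinearMap.eq_adjoint_iff]
  intro ξ η
  rw [lp.inner_eq_tsum, lp.inner_eq_tsum,
    ← ((Equiv.mulLeft s).prodCongr (Equiv.refl X)).tsum_eq
      (fun p => inner ℂ (ξ p) (groupRep Γ X s η p))]
  refine tsum_congr fun p => ?_
  rw [groupRep_apply, groupRep_apply, inv_inv]
  simp only [Equiv.prodCongr_apply, Prod.map_fst, Equiv.coe_mulLeft, inv_mul_cancel_left,
    Prod.map_snd, Equiv.refl_apply]
  rfl

lemma coeffRep_algebraMap (r : ℂ) :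
    coeffRep Γ X (algebraMap ℂ C(X, ℂ) r) = algebraMap ℂ _ r := by
  ext ξ p
  rw [coeffRep_apply, Algebra.algebraMap_eq_smul_one, Algebra.algebraMap_eq_smul_one]
  simp

lemma groupRep_mul (s t : Γ) : groupRep Γ X (s * t) = groupRep Γ X s * groupRep Γ X t := by
  ext ξ p
  rw [mul_apply_eq_comp, groupRep_apply, groupRep_apply, groupRep_apply, mul_inv_rev, mul_assoc]

lemma coeffRep_mem (f : C(X, ℂ)) : coeffRep Γ X f ∈ reducedSubalgebra Γ X :=
  StarSubalgebra.le_topologicalClosure _ (StarAlgebra.subset_adjoin _ _ (Or.inl ⟨f, rfl⟩))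

lemma groupRep_mem (s : Γ) : groupRep Γ X s ∈ reducedSubalgebra Γ X :=
  StarSubalgebra.le_topologicalClosure _ (StarAlgebra.subset_adjoin _ _ (Or.inr ⟨s, rfl⟩))

/-- The inclusion of the reduced crossed product into the bounded operators on `ℓ²(Γ × X)`. -/
def toOperator : ReducedCrossedProduct Γ X →⋆ₐ[ℂ] (EllTwo (Γ × X) →L[ℂ] EllTwo (Γ × X)) :=
  (reducedSubalgebra Γ X).subtype

lemma toOperator_injective : Function.Injective (toOperator Γ X) := Subtype.val_injective

lemma norm_toOperator (a : ReducedCrossedProduct Γ X) : ‖toOperator Γ X a‖ = ‖a‖ := rfl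

/-- The inclusion of `C(X)` into the reduced crossed product. -/
def coeff : C(X, ℂ) →⋆ₐ[ℂ] ReducedCrossedProduct Γ X where
  toFun f := (⟨coeffRep Γ X f, coeffRep_mem Γ X f⟩ : reducedSubalgebra Γ X)
  map_one' := toOperator_injective Γ X <| by
    ext ξ p; exact one_mul _
  map_mul' f g := toOperator_injective Γ X <| by
    ext ξ p; exact mul_assoc _ _ _
  map_zero' := toOperator_injective Γ X <| by
    ext ξ p; exact zero_mul _
  map_add' f g := toOperator_injective Γ X <| by
    ext ξ p; exact add_mul _ _ _
  commutes' r := toOperator_injective Γ X (coeffRep_algebraMap Γ X r)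
  map_star' f := toOperator_injective Γ X (star_coeffRep Γ X f).symm

/-- The canonical unitaries in the reduced crossed product. -/
def groupUnitary : Γ →* ReducedCrossedProduct Γ X where
  toFun s := (⟨groupRep Γ X s, groupRep_mem Γ X s⟩ : reducedSubalgebra Γ X)
  map_one' := toOperator_injective Γ X <| by
    ext ξ p
    refine (groupRep_apply Γ X 1 ξ p).trans ?_
    simp
  map_mul' s t := toOperator_injective Γ X (groupRep_mul Γ X s t)

lemma toOperator_coeff (f : C(X, ℂ)) : toOperator Γ X (coeff Γ X f) = coeffRep Γ X f := rfl

lemma toOperator_groupUnitary (s : Γ) :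
    toOperator Γ X (groupUnitary Γ X s) = groupRep Γ X s := rfl

lemma star_groupUnitary (s : Γ) : star (groupUnitary Γ X s) = groupUnitary Γ X s⁻¹ :=
  toOperator_injective Γ X <| by
    rw [map_star]; exact star_groupRep Γ X s

lemma norm_coeff_le (f : C(X, ℂ)) : ‖coeff Γ X f‖ ≤ ‖f‖ :=
  NonUnitalStarAlgHom.norm_apply_le (coeff Γ X) f

variable {Γ X} in
/-- The translate `x ↦ f (s⁻¹ x)` of a continuous function. -/
def translate [ContinuousConstSMul Γ X] (s : Γ) (f : C(X, ℂ)) : C(X, ℂ) :=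
  f.comp ⟨fun x => s⁻¹ • x, continuous_const_smul _⟩

variable {Γ X} in
lemma translate_apply [ContinuousConstSMul Γ X] (s : Γ) (f : C(X, ℂ)) (x : X) :
    translate s f x = f (s⁻¹ • x) := rfl

/-- The covariance relation. It collects the unitaries on the right, so that finite sums form a
`*`-algebra. -/
lemma groupUnitary_mul_coeff [ContinuousConstSMul Γ X] (s : Γ) (f : C(X, ℂ)) :
    groupUnitary Γ X s * coeff Γ X f = coeff Γ X (translate s f) * groupUnitary Γ X s :=
  toOperator_injective Γ X <| by
    ext ξ p
    simp only [map_mul, toOperator_coeff, toOperator_groupUnitary, mul_apply_eq_comp,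
      coeffRep_apply, groupRep_apply, translate_apply, mul_smul]

/-- The basis vector at `(1, x)` recovers the value `f x`. -/
lemma coeff_injective : Function.Injective (coeff Γ X) := by
  classical
  refine (injective_iff_map_eq_zero _).2 fun f hf => ContinuousMap.ext fun x => ?_
  have h := congrArg (fun a => toOperator Γ X a (lp.single 2 ((1 : Γ), x) (1 : ℂ)) (1, x)) hf
  simpa [toOperator_coeff, coeffRep_apply] using h

/-- The finite sum `∑ c_s λ_s` attached to a finitely supported function `c : Γ → C(X)`. -/
def finiteSum : (Γ →₀ C(X, ℂ)) →ₗ[ℂ] ReducedCrossedProduct Γ X :=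
  Finsupp.lsum ℂ fun s =>
    (LinearMap.mulRight ℂ (groupUnitary Γ X s)).comp (coeff Γ X).toAlgHom.toLinearMap

lemma finiteSum_single (s : Γ) (f : C(X, ℂ)) :
    finiteSum Γ X (Finsupp.single s f) = coeff Γ X f * groupUnitary Γ X s := by
  simp [finiteSum]

lemma finiteSum_apply (c : Γ →₀ C(X, ℂ)) :
    finiteSum Γ X c = ∑ s ∈ c.support, coeff Γ X (c s) * groupUnitary Γ X s := by
  simp [finiteSum, Finsupp.sum]

lemma finiteSum_mul_mem_range [ContinuousConstSMul Γ X] (c d : Γ →₀ C(X, ℂ)) :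
    finiteSum Γ X c * finiteSum Γ X d ∈ LinearMap.range (finiteSum Γ X) := by
  induction c using Finsupp.induction_linear with
  | zero => simp
  | add c₁ c₂ h₁ h₂ => rw [map_add, add_mul]; exact add_mem h₁ h₂
  | single s f =>
    induction d using Finsupp.induction_linear with
    | zero => simp
    | add d₁ d₂ h₁ h₂ => rw [map_add, mul_add]; exact add_mem h₁ h₂
    | single t g =>
      refine ⟨Finsupp.single (s * t) (f * translate s g), ?_⟩
      rw [finiteSum_single, finiteSum_single, finiteSum_single, map_mul, map_mul, mul_assoc,
        mul_assoc, ← mul_assoc (groupUnitary Γ X s), groupUnitary_mul_coeff, mul_assoc]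

lemma star_finiteSum_mem_range [ContinuousConstSMul Γ X] (c : Γ →₀ C(X, ℂ)) :
    star (finiteSum Γ X c) ∈ LinearMap.range (finiteSum Γ X) := by
  induction c using Finsupp.induction_linear with
  | zero => simp
  | add c₁ c₂ h₁ h₂ => rw [map_add, star_add]; exact add_mem h₁ h₂
  | single s f =>
    refine ⟨Finsupp.single s⁻¹ (translate s⁻¹ (star f)), ?_⟩
    rw [finiteSum_single, finiteSum_single, star_mul, star_groupUnitary, ← map_star,
      groupUnitary_mul_coeff]

/-- The finite sums `∑ c_s λ_s` are dense in the reduced crossed product. -/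
lemma exists_norm_sub_finiteSum_lt [ContinuousConstSMul Γ X] (a : ReducedCrossedProduct Γ X)
    {ε : ℝ} (hε : 0 < ε) : ∃ c : Γ →₀ C(X, ℂ), ‖a - finiteSum Γ X c‖ < ε := by
  have key : ∀ T ∈ StarAlgebra.adjoin ℂ (Set.range (coeffRep Γ X) ∪ Set.range (groupRep Γ X)),
      ∃ c, toOperator Γ X (finiteSum Γ X c) = T := by
    intro T hT
    induction hT using StarAlgebra.adjoin_induction with
    | mem T h =>
      rcases h with ⟨f, rfl⟩ | ⟨s, rfl⟩
      · exact ⟨Finsupp.single 1 f, by rw [finiteSum_single, map_one, mul_one]; rfl⟩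
      · exact ⟨Finsupp.single s 1, by rw [finiteSum_single, map_one, one_mul]; rfl⟩
    | algebraMap r =>
      refine ⟨Finsupp.single 1 (algebraMap ℂ _ r), ?_⟩
      rw [finiteSum_single, map_one, mul_one, AlgHomClass.commutes, AlgHomClass.commutes]
    | add S T _ _ hS hT =>
      obtain ⟨c, rfl⟩ := hS
      obtain ⟨d, rfl⟩ := hT
      exact ⟨c + d, by rw [map_add, map_add]⟩
    | mul S T _ _ hS hT =>
      obtain ⟨c, rfl⟩ := hS
      obtain ⟨d, rfl⟩ := hT
      obtain ⟨e, he⟩ := finiteSum_mul_mem_range Γ X c d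
      exact ⟨e, by rw [he, map_mul]⟩
    | star T _ hT =>
      obtain ⟨c, rfl⟩ := hT
      obtain ⟨e, he⟩ := star_finiteSum_mem_range Γ X c
      exact ⟨e, by rw [he, map_star]⟩
  have ha : toOperator Γ X a ∈ closure (StarAlgebra.adjoin ℂ
      (Set.range (coeffRep Γ X) ∪ Set.range (groupRep Γ X)) : Set _) := a.2
  obtain ⟨T, hT, hlt⟩ := Metric.mem_closure_iff.1 ha ε hε
  obtain ⟨c, rfl⟩ := key T hT
  exact ⟨c, by rwa [dist_eq_norm, ← map_sub, norm_toOperator] at hlt⟩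

/-- The diagonal matrix coefficients of a finite sum are given by its coefficient at `1`. -/
lemma inner_single_finiteSum [DecidableEq (Γ × X)] (c : Γ →₀ C(X, ℂ)) (p : Γ × X) :
    inner ℂ (lp.single 2 p (1 : ℂ) : EllTwo (Γ × X))
      (toOperator Γ X (finiteSum Γ X c) (lp.single 2 p (1 : ℂ))) = c 1 (p.1 • p.2) := by
  rw [lp.inner_single_left, RCLike.inner_apply, map_one, mul_one]
  induction c using Finsupp.induction_linear with
  | zero => simp
  | add c₁ c₂ h₁ h₂ =>
    rw [map_add, map_add, add_apply, lp.coeFn_add, Pi.add_apply, h₁, h₂]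
    rfl
  | single s f =>
    classical
    rw [finiteSum_single, map_mul, mul_apply_eq_comp, toOperator_coeff,
      toOperator_groupUnitary, coeffRep_apply, groupRep_apply, lp.single_apply]
    by_cases hs : s = 1
    · subst hs; simp
    -- For `s ≠ 1` the unitary moves the basis vector at `p` to an orthogonal one.
    · rw [Finsupp.single_eq_of_ne (Ne.symm hs), Pi.single_eq_of_ne]
      · simp
      · intro h
        have := congrArg Prod.fst h
        simp at this
        exact hs this

/-- A nonzero positive element has a nonzero diagonal matrix coefficient. -/
lemma exists_inner_single_pos [DecidableEq (Γ × X)] {a : ReducedCrossedProduct Γ X} (ha : 0 ≤ a)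
    (ha0 : a ≠ 0) : ∃ (p : Γ × X) (r : ℝ), 0 < r ∧
      inner ℂ (lp.single 2 p (1 : ℂ) : EllTwo (Γ × X))
        (toOperator Γ X a (lp.single 2 p (1 : ℂ))) = (r : ℂ) := by
  -- The coefficient of `b* b` at `p` is the squared norm of `b` applied to the basis vector; if all
  -- of them vanish, then `b = 0`.
  obtain ⟨b, rfl⟩ := CStarAlgebra.nonneg_iff_eq_star_mul_self.1 ha
  set T := toOperator Γ X b with hT
  have hin : ∀ p : Γ × X, inner ℂ (lp.single 2 p (1 : ℂ) : EllTwo (Γ × X))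
      (toOperator Γ X (star b * b) (lp.single 2 p (1 : ℂ))) =
      ((‖T (lp.single 2 p (1 : ℂ))‖ ^ 2 : ℝ) : ℂ) := by
    intro p
    rw [map_mul, map_star, ContinuousLinearMap.star_eq_adjoint, mul_apply_eq_comp,
      ContinuousLinearMap.adjoint_inner_right, inner_self_eq_norm_sq_to_K]
    push_cast
    rfl
  by_contra! hcon
  refine ha0 ?_
  have hzero : ∀ p : Γ × X, T (lp.single 2 p (1 : ℂ)) = 0 := by
    intro p
    by_contra hne
    exact hcon p _ (by positivity) (hin p)
  have hb : b = 0 := by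
    refine toOperator_injective Γ X ?_
    rw [map_zero]
    refine ContinuousLinearMap.ext fun ξ => ?_
    have h1 := (lp.hasSum_single (by norm_num) ξ).mapL T
    have h2 : ∀ p, T (lp.single 2 p (ξ p)) = 0 := fun p => by
      have : (lp.single 2 p (ξ p) : EllTwo (Γ × X)) = ξ p • lp.single 2 p (1 : ℂ) := by
        rw [← lp.single_smul, smul_eq_mul, mul_one]
      rw [this, map_smul, hzero, smul_zero]
    simp only [h2] at h1
    exact h1.unique hasSum_zero
  rw [hb, mul_zero]

end Generators

/-! ### Transfer of finite sums along the factor map. -/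

section FactorMap

variable {Γ : Type u} {X : Type v} {Y : Type w}

/-- Used twice: for the square-summability in the definition of `fibreMap`, and for the norm of its
values. -/
lemma hasSum_fibre (π : Y → X) (y : Y) [DecidableEq X] (ξ : EllTwo (Γ × Y)) :
    HasSum (fun p : Γ × X => ‖if p.2 = π y then ξ (p.1, y) else 0‖ ^ (2 : ℝ))
      (∑' g, ‖ξ (g, y)‖ ^ (2 : ℝ)) := by
  have hinj : Function.Injective fun g : Γ => (g, π y) := fun g h e => congrArg Prod.fst e
  have hinj' : Function.Injective fun g : Γ => (g, y) := fun g h e => congrArg Prod.fst e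
  have hξ : Summable fun q : Γ × Y => ‖ξ q‖ ^ (2 : ℝ) := by
    have h := (lp.hasSum_norm (p := 2) (by norm_num) ξ).summable
    simpa only [ENNReal.toReal_ofNat] using h
  rw [← hinj.hasSum_iff]
  · simpa [Function.comp_def] using (hξ.comp_injective hinj').hasSum
  · rintro ⟨g, x⟩ hx
    have : x ≠ π y := fun h => hx ⟨g, by rw [h]⟩
    simp [this]

open Classical in
/-- For a map `π : Y → X` and `y ∈ Y`, the restriction of a vector in `ℓ²(Γ × Y)` to `Γ × {y}`,
viewed as a vector in `ℓ²(Γ × X)` supported on `Γ × {π y}`. -/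
def fibreMap (π : Y → X) (y : Y) : EllTwo (Γ × Y) →ₗ[ℂ] EllTwo (Γ × X) where
  toFun ξ := ⟨fun p => if p.2 = π y then ξ (p.1, y) else 0, memℓp_gen (by
    simpa only [ENNReal.toReal_ofNat] using (hasSum_fibre π y ξ).summable)⟩
  map_add' ξ η := by
    ext p
    change (if p.2 = π y then ξ (p.1, y) + η (p.1, y) else 0) =
      (if p.2 = π y then ξ (p.1, y) else 0) + (if p.2 = π y then η (p.1, y) else 0)
    split_ifs <;> simp
  map_smul' c ξ := by
    ext p
    change (if p.2 = π y then c * ξ (p.1, y) else 0) =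
      c * (if p.2 = π y then ξ (p.1, y) else 0)
    split_ifs <;> simp

open Classical in
lemma fibreMap_apply (π : Y → X) (y : Y) (ξ : EllTwo (Γ × Y)) (p : Γ × X) :
    fibreMap π y ξ p = if p.2 = π y then ξ (p.1, y) else 0 := rfl

/-- The vector `ξ ∈ ℓ²(Γ × Y)` is the orthogonal sum of its restrictions to `Γ × {y}`. -/
lemma hasSum_norm_fibreMap (π : Y → X) (ξ : EllTwo (Γ × Y)) :
    HasSum (fun y => ‖fibreMap π y ξ‖ ^ (2 : ℝ)) (‖ξ‖ ^ (2 : ℝ)) := by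
  classical
  have hξ : HasSum (fun q : Γ × Y => ‖ξ q‖ ^ (2 : ℝ)) (‖ξ‖ ^ (2 : ℝ)) := by
    have h := lp.hasSum_norm (p := 2) (by norm_num) ξ
    simpa only [ENNReal.toReal_ofNat] using h
  -- The coordinates are swapped so that the inner sum runs over `Γ` with `y` fixed.
  have hξ' := (Equiv.prodComm Y Γ).hasSum_iff.2 hξ
  refine hξ'.prod_fiberwise fun y => ?_
  have h1 : HasSum (fun p : Γ × X => ‖fibreMap π y ξ p‖ ^ (2 : ℝ))
      (‖fibreMap π y ξ‖ ^ (2 : ℝ)) := by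
    have h := lp.hasSum_norm (p := 2) (by norm_num) (fibreMap π y ξ)
    simpa only [ENNReal.toReal_ofNat] using h
  have h2 : HasSum (fun p : Γ × X => ‖fibreMap π y ξ p‖ ^ (2 : ℝ))
      (∑' g, ‖ξ (g, y)‖ ^ (2 : ℝ)) := hasSum_fibre π y ξ
  rw [h1.unique h2]
  have hinj' : Function.Injective fun g : Γ => (g, y) := fun g h e => congrArg Prod.fst e
  exact (hξ.summable.comp_injective hinj').hasSum

/-- An operator on `ℓ²(Γ × Y)` intertwined with `T` by all the fibre maps has norm at most
`‖T‖`. -/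
lemma norm_le_of_fibreMap_comp (π : Y → X) {T : EllTwo (Γ × X) →L[ℂ] EllTwo (Γ × X)}
    {S : EllTwo (Γ × Y) →L[ℂ] EllTwo (Γ × Y)}
    (h : ∀ y ξ, fibreMap π y (S ξ) = T (fibreMap π y ξ)) : ‖S‖ ≤ ‖T‖ := by
  refine S.opNorm_le_bound (norm_nonneg _) fun ξ => ?_
  rw [← Real.rpow_le_rpow_iff (norm_nonneg _) (by positivity) (zero_lt_two (α := ℝ)),
    Real.mul_rpow (norm_nonneg _) (norm_nonneg _)]
  refine hasSum_le (fun y => ?_) (hasSum_norm_fibreMap π (S ξ))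
    ((hasSum_norm_fibreMap π ξ).mul_left _)
  rw [h, ← Real.mul_rpow (norm_nonneg _) (norm_nonneg _)]
  exact Real.rpow_le_rpow (norm_nonneg _) (T.le_opNorm _) zero_le_two

variable [Group Γ] [TopologicalSpace X] [CompactSpace X] [MulAction Γ X]
  [TopologicalSpace Y] [CompactSpace Y] [MulAction Γ Y]

/-- The elements `a ∈ C(X) ⋊_r Γ` and `b ∈ C(Y) ⋊_r Γ` are intertwined by all the fibre maps of
`π : Y → X`. -/
def Intertwined (π : Y → X) (a : ReducedCrossedProduct Γ X) (b : ReducedCrossedProduct Γ Y) :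
    Prop :=
  ∀ y ξ, fibreMap π y (toOperator Γ Y b ξ) = toOperator Γ X a (fibreMap π y ξ)

namespace Intertwined

variable {π : Y → X} {a a' : ReducedCrossedProduct Γ X} {b b' : ReducedCrossedProduct Γ Y}

/-- This bound replaces a homomorphism between the crossed products; the lemmas below make the
relation stable under the algebraic operations. -/
lemma norm_le (h : Intertwined π a b) : ‖b‖ ≤ ‖a‖ := norm_le_of_fibreMap_comp π h

lemma zero : Intertwined π (0 : ReducedCrossedProduct Γ X) 0 := fun y ξ => by
  simp only [map_zero, zero_apply]

lemma one : Intertwined π (1 : ReducedCrossedProduct Γ X) 1 := fun y ξ => by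
  simp only [map_one, one_apply_eq_self]

lemma add (h : Intertwined π a b) (h' : Intertwined π a' b') :
    Intertwined π (a + a') (b + b') := fun y ξ => by
  rw [map_add, map_add, add_apply, add_apply, map_add, h, h']

lemma sub (h : Intertwined π a b) (h' : Intertwined π a' b') :
    Intertwined π (a - a') (b - b') := fun y ξ => by
  rw [map_sub, map_sub, sub_apply, sub_apply, map_sub, h, h']

lemma mul (h : Intertwined π a b) (h' : Intertwined π a' b') :
    Intertwined π (a * a') (b * b') := fun y ξ => by
  rw [map_mul, map_mul, mul_apply_eq_comp, mul_apply_eq_comp, h, h']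

lemma coeff {π : C(Y, X)} (hπ : ∀ (g : Γ) (y : Y), π (g • y) = g • π y) (f : C(X, ℂ)) :
    Intertwined π (coeff Γ X f) (coeff Γ Y (f.comp π)) := fun y ξ => by
  ext p
  rw [toOperator_coeff, toOperator_coeff, coeffRep_apply, fibreMap_apply, fibreMap_apply,
    coeffRep_apply]
  split_ifs with hp
  · simp [hπ, hp]
  · simp

lemma groupUnitary (π : Y → X) (s : Γ) :
    Intertwined π (groupUnitary Γ X s) (groupUnitary Γ Y s) := fun y ξ => by
  ext p
  rw [toOperator_groupUnitary, toOperator_groupUnitary, groupRep_apply, fibreMap_apply,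
    fibreMap_apply, groupRep_apply]

end Intertwined

/-- Taking adjoints reverses the fibre maps, so the relation for the adjoints is carried through the
induction separately. Both halves are needed to transfer `x f x*`. -/
lemma exists_intertwined_finiteSum {π : C(Y, X)} (hπ : ∀ (g : Γ) (y : Y), π (g • y) = g • π y)
    (c : Γ →₀ C(X, ℂ)) : ∃ b : ReducedCrossedProduct Γ Y,
      Intertwined π (finiteSum Γ X c) b ∧ Intertwined π (star (finiteSum Γ X c)) (star b) := by
  induction c using Finsupp.induction_linear with
  | zero =>
    refine ⟨0, ?_⟩
    rw [map_zero, star_zero, star_zero]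
    exact ⟨.zero, .zero⟩
  | add c₁ c₂ h₁ h₂ =>
    obtain ⟨b₁, h₁, h₁'⟩ := h₁
    obtain ⟨b₂, h₂, h₂'⟩ := h₂
    refine ⟨b₁ + b₂, ?_⟩
    rw [map_add, star_add, star_add]
    exact ⟨h₁.add h₂, h₁'.add h₂'⟩
  | single s f =>
    refine ⟨coeff Γ Y (f.comp π) * groupUnitary Γ Y s, ?_⟩
    rw [finiteSum_single, star_mul, star_mul, star_groupUnitary, star_groupUnitary, ← map_star,
      ← map_star]
    exact ⟨(Intertwined.coeff hπ f).mul (.groupUnitary π s),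
      (Intertwined.groupUnitary π s⁻¹).mul (Intertwined.coeff hπ (star f))⟩

/-- If a function `f ∈ C(X)` can be conjugated to `1` in `C(X) ⋊_r Γ`, then its pullback can be
conjugated to an element close to `1` in `C(Y) ⋊_r Γ`. -/
lemma exists_norm_conj_comp_sub_one_lt [ContinuousConstSMul Γ X] {π : C(Y, X)}
    (hπ : ∀ (g : Γ) (y : Y), π (g • y) = g • π y) {f : C(X, ℂ)}
    {x : ReducedCrossedProduct Γ X} (hx : x * coeff Γ X f * star x = 1) {ε : ℝ} (hε : 0 < ε) :
    ∃ b : ReducedCrossedProduct Γ Y, ‖b * coeff Γ Y (f.comp π) * star b - 1‖ < ε := by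
  have hcont : Continuous fun z : ReducedCrossedProduct Γ X => z * coeff Γ X f * star z := by
    fun_prop
  obtain ⟨δ, hδ, hball⟩ := Metric.continuous_iff.1 hcont x ε hε
  obtain ⟨c, hc⟩ := exists_norm_sub_finiteSum_lt Γ X x hδ
  have h1 := hball (finiteSum Γ X c) (by rwa [dist_comm, dist_eq_norm])
  rw [hx, dist_eq_norm] at h1
  obtain ⟨b, hb, hb'⟩ := exists_intertwined_finiteSum hπ c
  exact ⟨b, (((hb.mul (.coeff hπ f)).mul hb').sub .one).norm_le.trans_lt h1⟩

end FactorMap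

/-! ### Essential freeness of extensions, and bump functions. -/

section Dynamics

variable {Γ : Type u} {X : Type v} {Y : Type w} [Group Γ] [TopologicalSpace X] [MulAction Γ X]
  [TopologicalSpace Y] [MulAction Γ Y]

/-- A minimal extension of an essentially free action is essentially free. -/
lemma EssentiallyFree.of_extension [T2Space X] [ContinuousConstSMul Γ X] [CompactSpace Y]
    [ContinuousConstSMul Γ Y] [Nonempty X] (hfree : EssentiallyFree Γ X)
    (hmin : MulAction.IsMinimal Γ Y) (hext : IsExtension Γ Y X) : EssentiallyFree Γ Y := by
  obtain ⟨π, hquot, hequiv⟩ := hext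
  intro g hg
  by_contra hne
  -- If `g` fixed an open set of `Y`, finitely many translates of it would cover `Y`, and `X` would
  -- be a finite union of fixed point sets of conjugates of `g`. These are closed with empty
  -- interior.
  obtain ⟨I, hI⟩ := isCompact_univ.exists_finite_cover_smul Γ
    (isOpen_interior (s := MulAction.fixedBy Y g)) (Set.nonempty_iff_ne_empty.2 hne)
  have hclosed : ∀ t : Γ, IsClosed (MulAction.fixedBy X t) := fun t =>
    isClosed_eq (continuous_const_smul t) continuous_id
  have hcover : (⋃ t ∈ I, MulAction.fixedBy X (t * g * t⁻¹)) = Set.univ := by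
    refine Set.eq_univ_of_forall fun x => ?_
    obtain ⟨y, rfl⟩ := hquot.surjective x
    obtain ⟨t, ht, z, hz, rfl⟩ := by simpa using hI (Set.mem_univ y)
    have hz' : z ∈ MulAction.fixedBy Y g := interior_subset hz
    refine Set.mem_biUnion ht ?_
    rw [MulAction.mem_fixedBy, ← hequiv, mul_smul, mul_smul, inv_smul_smul,
      MulAction.mem_fixedBy.1 hz']
  have hempty : ∀ J : Finset Γ, interior (⋃ t ∈ J, MulAction.fixedBy X (t * g * t⁻¹)) = ∅ := by
    classical
    intro J
    induction J using Finset.induction_on with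
    | empty => simp
    | insert t J _ ih =>
      rw [Finset.set_biUnion_insert, interior_union_isClosed_of_interior_empty (hclosed _) ih]
      exact hfree _ (by simpa [conj_eq_one_iff] using hg)
  have := hempty I
  rw [hcover, interior_univ] at this
  exact Set.univ_nonempty.ne_empty this

/-- In an essentially free action, every nonempty open set carries a bump function whose
translates by finitely many prescribed nontrivial group elements are orthogonal to it. -/
lemma EssentiallyFree.exists_bump [CompactSpace X] [T2Space X] [ContinuousConstSMul Γ X]
    (hfree : EssentiallyFree Γ X) (F : Finset Γ) {V : Set X} (hV : IsOpen V)
    (hVne : V.Nonempty) : ∃ f : C(X, ℂ), f ≠ 0 ∧ star f = f ∧ (∀ x ∉ V, f x = 0) ∧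
      ∀ s ∈ F, s ≠ 1 → f * translate s f = 0 := by
  classical
  -- Shrink `V` for one group element at a time: a point of `U` moved by `s⁻¹` has a neighbourhood
  -- that `s⁻¹` carries off itself.
  obtain ⟨U, hU, hUne, hUV, hUF⟩ : ∃ U : Set X, IsOpen U ∧ U.Nonempty ∧ U ⊆ V ∧
      ∀ s ∈ F, s ≠ 1 → ∀ x ∈ U, s⁻¹ • x ∉ U := by
    induction F using Finset.induction_on with
    | empty => exact ⟨V, hV, hVne, subset_rfl, by simp⟩
    | insert s F _ ih =>
      obtain ⟨U, hU, hUne, hUV, hUF⟩ := ih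
      by_cases hs : s = 1
      · refine ⟨U, hU, hUne, hUV, fun t ht ht1 => hUF t ?_ ht1⟩
        exact (Finset.mem_insert.1 ht).resolve_left fun h => ht1 (h.trans hs)
      · obtain ⟨x, hxU, hx⟩ : ∃ x ∈ U, s⁻¹ • x ≠ x := by
          by_contra! hcon
          have : U ⊆ interior (MulAction.fixedBy X s⁻¹) := interior_maximal hcon hU
          rw [hfree s⁻¹ (inv_ne_one.2 hs)] at this
          exact hUne.ne_empty (Set.subset_empty_iff.1 this)
        obtain ⟨A, B, hA, hB, hxA, hxB, hAB⟩ := t2_separation hx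
        refine ⟨U ∩ (B ∩ (fun z => s⁻¹ • z) ⁻¹' A),
          hU.inter (hB.inter (hA.preimage (continuous_const_smul _))), ⟨x, hxU, hxB, hxA⟩,
          Set.inter_subset_left.trans hUV, fun t ht ht1 z hz hz' => ?_⟩
        rcases Finset.mem_insert.1 ht with rfl | ht
        · exact Set.disjoint_left.1 hAB hz.2.2 hz'.2.1
        · exact hUF t ht ht1 z hz.1 hz'.1
  obtain ⟨x, hx⟩ := hUne
  obtain ⟨f, hf0, hf1, -⟩ := exists_continuous_zero_one_of_isClosed hU.isClosed_compl
    (isClosed_singleton (x := x)) (by simpa using hx)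
  refine ⟨⟨fun z => (f z : ℂ), by fun_prop⟩, fun h => ?_, ?_, fun z hz => ?_, fun s hs hs1 => ?_⟩
  · have h1 := DFunLike.congr_fun h x
    have h2 : f x = 1 := hf1 rfl
    simp [h2] at h1
  · ext z; simp
  · have : f z = 0 := hf0 fun h => hz (hUV h)
    simp [this]
  · ext z
    by_cases hz : z ∈ U
    · have : f (s⁻¹ • z) = 0 := hf0 (hUF s hs hs1 z hz)
      simp [translate_apply, this]
    · have : f z = 0 := hf0 hz
      simp [this]

end Dynamics

/-! ### Reduction from positive elements to functions. -/

section Compression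

variable {Γ : Type u} {Y : Type w} [Group Γ] [TopologicalSpace Y] [CompactSpace Y]
  [MulAction Γ Y] [ContinuousConstSMul Γ Y]

/-- Moved past the unitary, the right factor `f` becomes its translate, which annihilates the left
one. -/
lemma coeff_mul_mul_groupUnitary_mul_coeff {f : C(Y, ℂ)} {s : Γ} (h : f * translate s f = 0)
    (a : C(Y, ℂ)) : coeff Γ Y f * (coeff Γ Y a * groupUnitary Γ Y s) * coeff Γ Y f = 0 := by
  rw [mul_assoc, mul_assoc, groupUnitary_mul_coeff, ← mul_assoc, ← mul_assoc, ← map_mul,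
    ← map_mul, mul_right_comm, h, zero_mul, map_zero, zero_mul]

/-- Compressing a finite sum by a function orthogonal to its relevant translates leaves only the
coefficient at `1`. -/
lemma coeff_mul_finiteSum_mul_coeff {f : C(Y, ℂ)} {c : Γ →₀ C(Y, ℂ)}
    (h : ∀ s ∈ c.support, s ≠ 1 → f * translate s f = 0) :
    coeff Γ Y f * finiteSum Γ Y c * coeff Γ Y f = coeff Γ Y (f * c 1 * f) := by
  rw [finiteSum_apply, Finset.mul_sum, Finset.sum_mul, Finset.sum_eq_single 1]
  · rw [map_one (groupUnitary Γ Y), mul_one, map_mul, map_mul]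
  · exact fun s hs hs1 => coeff_mul_mul_groupUnitary_mul_coeff (h s hs hs1) _
  · intro h1
    rw [Finsupp.notMem_support_iff.1 h1, map_zero, zero_mul, mul_zero, zero_mul]

/-- Truncation of a continuous function: `w` has norm at most `R` and agrees with `v` where `v`
is bounded by `R`. -/
lemma exists_truncation (v : C(Y, ℂ)) {R : ℝ} (hR : 0 < R) :
    ∃ w : C(Y, ℂ), ‖w‖ ≤ R ∧ ∀ y, ‖v y‖ ≤ R → w y = v y := by
  have hpos : ∀ y, 0 < max R ‖v y‖ := fun y => lt_max_of_lt_left hR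
  have hne : ∀ y, max R ‖v y‖ ≠ 0 := fun y => (hpos y).ne'
  refine ⟨⟨fun y => v y * ((R / max R ‖v y‖ : ℝ) : ℂ), ?_⟩, ?_, fun y hy => ?_⟩
  · have : Continuous fun y => R / max R ‖v y‖ := by fun_prop (disch := assumption)
    fun_prop
  · refine (ContinuousMap.norm_le _ hR.le).2 fun y => ?_
    simp only [ContinuousMap.coe_mk, norm_mul, Complex.norm_real,
      Real.norm_of_nonneg (div_nonneg hR.le (hpos y).le)]
    rw [mul_div_left_comm]
    exact mul_le_of_le_one_right hR.le ((div_le_one (hpos y)).2 (le_max_right _ _))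
  · simp [max_eq_left hy, ne_of_gt hR]

/-- If squares of real-valued functions in `C(Y)` can be conjugated to `1` in `C(Y) ⋊_r Γ`, then so
can all nonzero positive elements. -/
lemma exists_conj_eq_one_of_coeff [T2Space Y] (hfree : EssentiallyFree Γ Y)
    (hC : ∀ f : C(Y, ℂ), f ≠ 0 → star f = f →
      ∃ k : ReducedCrossedProduct Γ Y, k * coeff Γ Y (f * f) * star k = 1)
    {a : ReducedCrossedProduct Γ Y} (ha : 0 ≤ a) (ha0 : a ≠ 0) :
    ∃ x : ReducedCrossedProduct Γ Y, x * a * star x = 1 := by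
  classical
  obtain ⟨p, r, hr, hpr⟩ := exists_inner_single_pos Γ Y ha ha0
  -- The final error is at most `r / 4` from this approximation plus `r / 2` from the variation of
  -- `c 1`, in total less than `r`.
  obtain ⟨c, hc⟩ := exists_norm_sub_finiteSum_lt Γ Y a (show 0 < r / 4 by positivity)
  set v : C(Y, ℂ) := c 1 - algebraMap ℂ C(Y, ℂ) r with hv
  have hv_apply : ∀ y, v y = c 1 y - r := fun y => by simp [hv]
  have hvp : ‖v (p.1 • p.2)‖ < r / 2 := by
    have hδ : ‖(lp.single 2 p (1 : ℂ) : EllTwo (Γ × Y))‖ = 1 := by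
      rw [lp.norm_single (by norm_num), norm_one]
    rw [hv_apply, ← hpr, ← inner_single_finiteSum Γ Y c p, ← inner_sub_right, ← sub_apply,
      ← map_sub]
    calc _ ≤ ‖(lp.single 2 p (1 : ℂ) : EllTwo (Γ × Y))‖ *
          ‖toOperator Γ Y (finiteSum Γ Y c - a) (lp.single 2 p (1 : ℂ))‖ := norm_inner_le_norm _ _
      _ ≤ 1 * (‖toOperator Γ Y (finiteSum Γ Y c - a)‖ * 1) := by
          rw [hδ]
          gcongr
          exact (ContinuousLinearMap.le_opNorm _ _).trans_eq (by rw [hδ])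
      _ < r / 2 := by
          rw [norm_toOperator, norm_sub_rev]
          linarith
  obtain ⟨f, hf0, hfs, hfV, hfF⟩ := hfree.exists_bump c.support
    (V := {y | ‖v y‖ < r / 2}) (isOpen_lt (by fun_prop) continuous_const) ⟨_, hvp⟩
  -- `f` vanishes where `v` is large, so `v` may be replaced by `w`, which is small in norm
  -- everywhere.
  obtain ⟨w, hwn, hw⟩ := exists_truncation v (half_pos hr)
  have hfw : f * c 1 * f = f * w * f + algebraMap ℂ C(Y, ℂ) r * (f * f) := by
    ext y
    have : f y * w y = f y * v y := by
      by_cases hy : ‖v y‖ < r / 2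
      · rw [hw y hy.le]
      · rw [hfV y hy, zero_mul, zero_mul]
    simp only [ContinuousMap.mul_apply, ContinuousMap.add_apply, this, hv_apply]
    simp
    ring
  obtain ⟨k, hk⟩ := hC f hf0 hfs
  set K := k * coeff Γ Y f with hK
  have hKs : star K = coeff Γ Y f * star k := by rw [hK, star_mul, ← map_star, hfs]
  have hKK : K * star K = 1 := by rw [hKs, hK, ← hk, map_mul]; simp only [mul_assoc]
  -- As `K` is a coisometry, conjugation by it does not increase norms.
  have hKn : ∀ z, ‖K * z * star K‖ ≤ ‖z‖ := by
    intro z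
    have h1 : ‖K‖ * ‖K‖ ≤ 1 := by
      rw [← CStarRing.norm_self_mul_star, hKK]
      nontriviality ReducedCrossedProduct Γ Y
      rw [norm_one]
    calc ‖K * z * star K‖ ≤ ‖K‖ * ‖z‖ * ‖K‖ := by
          refine (norm_mul_le _ _).trans ?_
          rw [norm_star]
          gcongr
          exact norm_mul_le _ _
      _ = ‖K‖ * ‖K‖ * ‖z‖ := by ring
      _ ≤ ‖z‖ := mul_le_of_le_one_left (norm_nonneg _) h1
  have hsum : K * finiteSum Γ Y c * star K = K * coeff Γ Y w * star K + (r : ℂ) • 1 := by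
    calc K * finiteSum Γ Y c * star K
        = k * (coeff Γ Y f * finiteSum Γ Y c * coeff Γ Y f) * star k := by
          rw [hKs, hK]; simp only [mul_assoc]
      _ = k * (coeff Γ Y f * coeff Γ Y w * coeff Γ Y f) * star k +
          (r : ℂ) • (k * coeff Γ Y (f * f) * star k) := by
          rw [coeff_mul_finiteSum_mul_coeff hfF, hfw, map_add, ← map_mul, ← map_mul,
            ← Algebra.smul_def, map_smul, mul_add, add_mul, mul_smul_comm, smul_mul_assoc]
      _ = _ := by
          rw [hk, hKs, hK]; simp only [mul_assoc]
  refine exists_conj_eq_one_of_norm_sub_lt (k := K) (r := r) ha ?_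
  calc ‖K * a * star K - (r : ℂ) • 1‖
      = ‖K * (a - finiteSum Γ Y c) * star K + K * coeff Γ Y w * star K‖ := by
        rw [mul_sub, sub_mul, hsum]; congr 1; abel
    _ ≤ ‖a - finiteSum Γ Y c‖ + ‖coeff Γ Y w‖ :=
        (norm_add_le _ _).trans (add_le_add (hKn _) (hKn _))
    _ < r := by linarith [norm_coeff_le Γ Y w]

end Compression

/-! ### Functions on a minimal extension. -/

section Extension

variable {Γ : Type u} {X : Type v} {Y : Type w} [Group Γ]
  [TopologicalSpace X] [CompactSpace X] [T2Space X] [MulAction Γ X] [ContinuousConstSMul Γ X]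
  [TopologicalSpace Y] [CompactSpace Y] [T2Space Y] [MulAction Γ Y] [ContinuousConstSMul Γ Y]

/-- For a minimal action, a nonzero function `f` has translates `t f`, `t ∈ I`, for a finite set
`I`, such that `∑ |t f|²` is invertible. -/
lemma exists_mul_sum_translate_eq_one (hmin : MulAction.IsMinimal Γ Y) {f : C(Y, ℂ)} (hf : f ≠ 0)
    (hfs : star f = f) : ∃ (I : Finset Γ) (q : C(Y, ℂ)), star q = q ∧
      q * q * ∑ t ∈ I, translate t (f * f) = 1 := by
  have hV : IsOpen {y | f y ≠ 0} := isOpen_ne_fun f.continuous continuous_const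
  obtain ⟨y₀, hy₀⟩ : {y | f y ≠ 0}.Nonempty := by
    by_contra hcon
    refine hf (ContinuousMap.ext fun y => ?_)
    by_contra hy
    exact hcon ⟨y, hy⟩
  obtain ⟨I, hI⟩ := isCompact_univ.exists_finite_cover_smul Γ hV ⟨y₀, hy₀⟩
  set M : Y → ℝ := fun y => ∑ t ∈ I, ‖f (t⁻¹ • y)‖ ^ 2 with hM
  have hMpos : ∀ y, 0 < M y := by
    intro y
    obtain ⟨t, ht, hty⟩ := Set.mem_iUnion₂.1 (hI (Set.mem_univ y))
    have hty' : f (t⁻¹ • y) ≠ 0 := Set.mem_smul_set_iff_inv_smul_mem.1 hty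
    exact Finset.sum_pos' (fun s _ => by positivity) ⟨t, ht, by positivity⟩
  have hMc : Continuous M := by
    refine continuous_finsetSum _ fun t _ => ?_
    have := continuous_const_smul (T := Y) t⁻¹
    fun_prop
  have hne : ∀ y, √(M y) ≠ 0 := fun y => (Real.sqrt_pos.2 (hMpos y)).ne'
  -- `M` is the sum of the translates of `f²`, so `q = M^(-1/2)`.
  refine ⟨I, ⟨fun y => (((√(M y))⁻¹ : ℝ) : ℂ), ?_⟩, ?_, ?_⟩
  · have : Continuous fun y => (√(M y))⁻¹ := (Real.continuous_sqrt.comp hMc).inv₀ hne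
    fun_prop
  · ext y
    simp
  · ext y
    have hsq : ∀ z, f z * f z = ((‖f z‖ ^ 2 : ℝ) : ℂ) := fun z => by
      have : star (f z) = f z := DFunLike.congr_fun hfs z
      rw [← Complex.normSq_eq_norm_sq, ← Complex.mul_conj, ← Complex.star_def, this]
    have hsum : (∑ t ∈ I, translate t (f * f)) y = ((M y : ℝ) : ℂ) := by
      rw [ContinuousMap.sum_apply, hM]
      push_cast
      refine Finset.sum_congr rfl fun t _ => ?_
      rw [translate_apply, ContinuousMap.mul_apply, hsq]
      push_cast
      rfl
    rw [ContinuousMap.mul_apply, hsum, ContinuousMap.mul_apply, ContinuousMap.coe_mk,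
      ← Complex.ofReal_mul, ← Complex.ofReal_mul, ← mul_inv, Real.mul_self_sqrt (hMpos y).le,
      inv_mul_cancel₀ (hMpos y).ne']
    simp

/-- In a minimal extension `Y` of a minimal essentially free action on `X` with purely infinite
crossed product, the square of a nonzero real-valued function on `Y` can be conjugated to `1`. -/
lemma exists_conj_coeff_eq_one (hfree : EssentiallyFree Γ X) [Nonempty X]
    (hpi : IsPurelyInfinite (ReducedCrossedProduct Γ X)) {π : C(Y, X)}
    (hπ : ∀ (g : Γ) (y : Y), π (g • y) = g • π y) (hmin : MulAction.IsMinimal Γ Y)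
    {f : C(Y, ℂ)} (hf : f ≠ 0) (hfs : star f = f) :
    ∃ k : ReducedCrossedProduct Γ Y, k * coeff Γ Y (f * f) * star k = 1 := by
  classical
  obtain ⟨I, q, hqs, hq⟩ := exists_mul_sum_translate_eq_one hmin hf hfs
  -- The elements `t * r⁻¹` are those that occur in the conjugate of `f²` by `∑ λ_t`. The bump lives
  -- on `X`, where pure infiniteness is given.
  obtain ⟨h, hh0, hhs, -, hhF⟩ := hfree.exists_bump
    (Finset.image₂ (fun t r => t * r⁻¹) I I) isOpen_univ Set.univ_nonempty
  have hhh : coeff Γ X (h * h) = star (coeff Γ X h) * coeff Γ X h := by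
    rw [← map_star, hhs, map_mul]
  have hh1 : coeff Γ X h ≠ 0 := fun e => hh0 (coeff_injective Γ X (e.trans (map_zero _).symm))
  obtain ⟨x, hx⟩ := hpi.2 (coeff Γ X (h * h)) (hhh ▸ star_mul_self_nonneg _)
    (by rw [hhh]; exact (CStarRing.star_mul_self_ne_zero_iff _).2 hh1)
  obtain ⟨b, hb⟩ := exists_norm_conj_comp_sub_one_lt hπ hx one_pos
  set h' : C(Y, ℂ) := h.comp π with hh'
  have hs' : star h' = h' := ContinuousMap.ext fun y => DFunLike.congr_fun hhs (π y)
  have hF' : ∀ t ∈ I, ∀ r ∈ I, t ≠ r → h' * translate (t * r⁻¹) h' = 0 := by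
    intro t ht r hr htr
    have h1 := hhF _ (Finset.mem_image₂_of_mem ht hr) (by rwa [Ne, mul_inv_eq_one])
    ext y
    have h2 := DFunLike.congr_fun h1 (π y)
    simpa only [ContinuousMap.mul_apply, translate_apply, hh', ContinuousMap.comp_apply, hπ,
      ContinuousMap.zero_apply]
      using h2
  set c : ReducedCrossedProduct Γ Y := ∑ t ∈ I, groupUnitary Γ Y t with hc
  have hcomp : coeff Γ Y h' * (c * coeff Γ Y (f * f) * star c) * coeff Γ Y h' =
      coeff Γ Y (h' * (∑ t ∈ I, translate t (f * f)) * h') := by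
    have h1 : c * coeff Γ Y (f * f) * star c = ∑ t ∈ I, ∑ r ∈ I,
        coeff Γ Y (translate t (f * f)) * groupUnitary Γ Y (t * r⁻¹) := by
      rw [hc, star_sum, Finset.sum_mul, Finset.sum_mul_sum]
      refine Finset.sum_congr rfl fun t _ => Finset.sum_congr rfl fun r _ => ?_
      rw [groupUnitary_mul_coeff, star_groupUnitary, mul_assoc, ← map_mul]
    rw [h1, Finset.mul_sum, Finset.sum_mul, Finset.mul_sum, Finset.sum_mul, map_sum]
    refine Finset.sum_congr rfl fun t ht => ?_
    rw [Finset.mul_sum, Finset.sum_mul, Finset.sum_eq_single t]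
    · rw [mul_inv_cancel, map_one, mul_one, map_mul, map_mul]
    · exact fun r hr hrt => coeff_mul_mul_groupUnitary_mul_coeff (hF' t ht r hr hrt.symm) _
    · exact fun hn => absurd ht hn
  have hpos : 0 ≤ coeff Γ Y (f * f) := by
    have : coeff Γ Y (f * f) = star (coeff Γ Y f) * coeff Γ Y f := by
      rw [← map_star, hfs, map_mul]
    exact this ▸ star_mul_self_nonneg _
  -- Reading from the right: `c` spreads `f²` over its translates, `h'` removes the cross terms, `q`
  -- cancels the sum, and `b` takes `h' * h'` to within `1` of the unit.
  refine exists_conj_eq_one_of_norm_sub_lt (k := b * coeff Γ Y q * coeff Γ Y h' * c) (r := 1)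
    hpos ?_
  have hfin : b * coeff Γ Y q * coeff Γ Y h' * c * coeff Γ Y (f * f) *
      star (b * coeff Γ Y q * coeff Γ Y h' * c) = b * coeff Γ Y (h' * h') * star b := by
    have h2 : q * (h' * (∑ t ∈ I, translate t (f * f)) * h') * q = h' * h' := by
      calc _ = (q * q * ∑ t ∈ I, translate t (f * f)) * (h' * h') := by ring
        _ = _ := by rw [hq, one_mul]
    rw [← h2, map_mul (coeff Γ Y) (q * _) q, map_mul (coeff Γ Y) q, ← hcomp]
    simp only [star_mul, ← map_star, hs', hqs, mul_assoc]
  rw [hfin, Complex.ofReal_one, one_smul]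
  exact hb

end Extension

end CrossedProduct

end

theorem mainTheorem7 {Γ : Type*} [Group Γ]
    {X : Type*} [TopologicalSpace X] [CompactSpace X] [T2Space X]
    [MulAction Γ X] [ContinuousConstSMul Γ X]
    (hmin : MulAction.IsMinimal Γ X)
    (hfree : CrossedProduct.EssentiallyFree Γ X)
    (hpi : CrossedProduct.IsPurelyInfinite (CrossedProduct.ReducedCrossedProduct Γ X))
    {Y : Type*} [TopologicalSpace Y] [CompactSpace Y] [T2Space Y]
    [MulAction Γ Y] [ContinuousConstSMul Γ Y]
    (hext : CrossedProduct.IsExtension Γ Y X)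
    (hminY : MulAction.IsMinimal Γ Y) :
    CrossedProduct.IsPurelyInfinite (CrossedProduct.ReducedCrossedProduct Γ Y) := by
  have hsimple := hpi.1
  -- Over an empty space the crossed product is zero, hence not simple.
  have hX : Nonempty X := by
    by_contra hX
    rw [not_nonempty_iff] at hX
    exact one_ne_zero (α := CrossedProduct.ReducedCrossedProduct Γ X)
      (CrossedProduct.toOperator_injective Γ X (by ext ξ p; exact hX.elim p.2))
  have hfreeY := hfree.of_extension hminY hext
  obtain ⟨π, hquot, hπ⟩ := hext
  obtain ⟨y, -⟩ := hquot.surjective hX.some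
  have : Nonempty Y := ⟨y⟩
  have : Nontrivial (CrossedProduct.ReducedCrossedProduct Γ Y) :=
    (CrossedProduct.coeff_injective Γ Y).nontrivial
  exact CrossedProduct.isPurelyInfinite_of_exists_conj_eq_one fun a ha ha0 =>
    CrossedProduct.exists_conj_eq_one_of_coeff hfreeY
      (fun f hf hfs => CrossedProduct.exists_conj_coeff_eq_one hfree hpi
        (π := ⟨π, hquot.continuous⟩) hπ hminY hf hfs) ha ha0
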